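/- Let $(R,\mu)$ be a $\sigma$-finite nonatomic measure space, let $1<p<\infty$, and let $v\colon R\to[0,\infty)$ be a $\mu$-measurable function. Its nondecreasing rearrangement $v_*\colon(0,\infty)\to[0,\infty]$ is $$v_*(t)=\sup\{s>0 : \mu(\{x\in R : v(x)<s\})<t\},\qquad \sup\emptyset=0 .$$ Suppose that $v_*$ is not identically zero on $(0,\mu(R))$ and that $v_*$ belongs to the Ariño–Muckenhoupt class $B_p$ on $(0,\mu(R))$, that is, there is a finite constant $C$ such that $$\int_r^{\mu(R)}\frac{v_*(t)}{t^p}\,dt\le \frac{C}{r^p}\int_0^r v_*(t)\,dt\qquad\text{for every } 0<r<\mu(R)$$ (if $\mu(R)=\infty$, this is the usual class $B_p$ on $(0,\infty)$). Then $v^{-1/(p-1)}\in(L^1+L^\infty)(R,\mu)$; that is, $v>0$ $\mu$-a.e. and there are $g\in L^1(R,\mu)$ and $h\in L^\infty(R,\mu)$ with $v^{-1/(p-1)}=g+h$ $\mu$-a.e. -/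

import Mathlib

open MeasureTheory Set
open scoped ENNReal NNReal

noncomputable section

namespace RearrangementHull

/-- A measure is nonatomic if every measurable set of positive measure contains a measurable
subset of strictly smaller positive measure. (Mathlib's `NoAtoms` only concerns singletons.) -/
def IsNonatomic {R : Type*} [MeasurableSpace R] (μ : Measure R) : Prop :=
  ∀ A : Set R, MeasurableSet A → 0 < μ A →
    ∃ B : Set R, MeasurableSet B ∧ B ⊆ A ∧ 0 < μ B ∧ μ B < μ A

/-- The lower distribution function `s ↦ μ {x : |f x| < s}`, for `s > 0`. -/
def lowerDistribution {R : Type*} [MeasurableSpace R] (μ : Measure R) (f : R → ℝ) (s : ℝ) :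
    ℝ≥0∞ :=
  μ {x | |f x| < s}

/-- The nondecreasing rearrangement `f_* t = sup {s > 0 : μ {|f| < s} < t}`, for `t > 0`, with
values in `[0, ∞]` (the supremum of the empty set is `0`). -/
def nondecreasingRearrangement {R : Type*} [MeasurableSpace R] (μ : Measure R) (f : R → ℝ)
    (t : ℝ) : ℝ≥0∞ :=
  ⨆ (s : ℝ) (_ : 0 < s) (_ : lowerDistribution μ f s < ENNReal.ofReal t), ENNReal.ofReal s

/-- The Ariño–Muckenhoupt condition `B_p` for a weight `w` on the interval `(0, a)`, `a ≤ ∞`: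
`∫_r^a w(t) t⁻ᵖ dt ≤ C r⁻ᵖ ∫_0^r w(t) dt` for all `0 < r < a`, with a finite constant `C`.
For `a = ∞` this is the classical class `B_p` on `(0, ∞)`. -/
def IsBp (p : ℝ) (a : ℝ≥0∞) (w : ℝ → ℝ≥0∞) : Prop :=
  ∃ C : ℝ≥0, ∀ r : ℝ, 0 < r → ENNReal.ofReal r < a →
    ∫⁻ t in {t : ℝ | r < t ∧ ENNReal.ofReal t < a}, w t / ENNReal.ofReal (t ^ p) ≤
      C * (1 / ENNReal.ofReal (r ^ p)) * ∫⁻ t in Ioc 0 r, w t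

/-- Membership in `(L¹ + L^∞)(R, μ)`. -/
def MemL1AddLinfty {R : Type*} [MeasurableSpace R] (μ : Measure R) (f : R → ℝ) : Prop :=
  ∃ g h : R → ℝ, MemLp g 1 μ ∧ MemLp h ∞ μ ∧ f =ᵐ[μ] g + h

end RearrangementHull

end

/-! Let `w` be the rearrangement and `H r` its tail integral. Since `w` is monotone, `B_p` gives `H
r ≤ C r^(1-p) w r`. Also by monotonicity, the part of `H (r/2)` over `(r/2, r]` is at least `w (r/2)
(r/2) r^(-p)`, hence at least a fixed multiple of `H r`. So halving `r` multiplies `H` by at least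
some `η > 1`, and `w (t₀/2^k) ≥ D (η/2^(p-1))^k` (`IsBp.exists_geometric_lower_bound`). This bounds
`μ {v < s k}` by `t₀/2^k` for comparable levels `s k`. With `γ = 1/(p-1)`, slicing `{v < s 0}` by
these levels bounds the integral of `v^(-γ)` there by a geometric series of ratio `η^(-γ) < 1`; off
that set `v^(-γ)` is bounded. -/

namespace RearrangementHull

/-! ### Self-improvement of monotone `B_p` weights -/

section Weight

variable {p : ℝ} {a : ℝ≥0∞} {w : ℝ → ℝ≥0∞}

/-- The tail integral `∫_r^a w(t) t⁻ᵖ dt` of a weight on `(0, a)`. -/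
noncomputable def tailIntegral (p : ℝ) (a : ℝ≥0∞) (w : ℝ → ℝ≥0∞) (r : ℝ) : ℝ≥0∞ :=
  ∫⁻ t in {t : ℝ | r < t ∧ ENNReal.ofReal t < a}, w t / ENNReal.ofReal (t ^ p)

theorem measurableSet_tail (a : ℝ≥0∞) (r : ℝ) :
    MeasurableSet {t : ℝ | r < t ∧ ENNReal.ofReal t < a} :=
  (measurableSet_lt measurable_const measurable_id).inter
    (measurableSet_lt ENNReal.measurable_ofReal measurable_const)

theorem tailIntegral_antitone : Antitone (tailIntegral p a w) := fun _ _ h =>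
  lintegral_mono_set fun _ ht => ⟨h.trans_lt ht.1, ht.2⟩

/-- A monotone weight integrates over `(r, s]` against `t⁻ᵖ` to at least `w(r) s⁻ᵖ (s - r)`. -/
theorem mul_le_setLIntegral_Ioc (hp : 0 ≤ p) (hw : Monotone w) {r s : ℝ} (hr : 0 < r) (hsr : r < s) :
    w r * ENNReal.ofReal ((s - r) / s ^ p) ≤
      ∫⁻ t in Ioc r s, w t / ENNReal.ofReal (t ^ p) := by
  have hs : 0 < s := hr.trans hsr
  calc w r * ENNReal.ofReal ((s - r) / s ^ p)
      = ∫⁻ _ in Ioc r s, w r / ENNReal.ofReal (s ^ p) := by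
        rw [setLIntegral_const, Real.volume_Ioc,
          ENNReal.ofReal_div_of_pos (Real.rpow_pos_of_pos hs p)]
        simp only [div_eq_mul_inv]
        ring
    _ ≤ _ := by
        refine setLIntegral_mono' measurableSet_Ioc fun t ht => ?_
        refine ENNReal.div_le_div (hw ht.1.le) (ENNReal.ofReal_le_ofReal ?_)
        exact Real.rpow_le_rpow (hr.trans ht.1).le ht.2 hp

theorem setLIntegral_Ioc_add_tailIntegral_le {r s : ℝ} (hrs : r ≤ s)
    (hs : ENNReal.ofReal s < a) :
    (∫⁻ t in Ioc r s, w t / ENNReal.ofReal (t ^ p)) + tailIntegral p a w s ≤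
      tailIntegral p a w r := by
  unfold tailIntegral
  rw [← lintegral_union (measurableSet_tail a s)]
  · refine lintegral_mono_set ?_
    rintro t (ht | ht)
    · exact ⟨ht.1, (ENNReal.ofReal_le_ofReal ht.2).trans_lt hs⟩
    · exact ⟨hrs.trans_lt ht.1, ht.2⟩
  · exact Set.disjoint_left.2 fun t ht ht' => absurd ht'.1 (not_lt.2 ht.2)

/-- For a monotone `B_p` weight, the tail integral is controlled by the weight itself. -/
theorem IsBp.exists_tailIntegral_le (h : IsBp p a w) (hw : Monotone w) :
    ∃ C : ℝ, 0 < C ∧ ∀ r : ℝ, 0 < r → ENNReal.ofReal r < a →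
      ENNReal.ofReal (r ^ (p - 1) / C) * tailIntegral p a w r ≤ w r := by
  obtain ⟨C, hC⟩ := h
  -- The `B_p` constant may be `0`; adding `1` makes it a legitimate divisor.
  refine ⟨C + 1, by positivity, fun r hr hra => ?_⟩
  have hint : ∫⁻ t in Ioc 0 r, w t ≤ w r * ENNReal.ofReal r := by
    calc ∫⁻ t in Ioc 0 r, w t ≤ ∫⁻ _ in Ioc 0 r, w r :=
          setLIntegral_mono' measurableSet_Ioc fun t ht => hw ht.2
      _ = _ := by rw [setLIntegral_const, Real.volume_Ioc, sub_zero]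
  have hrp : 0 < r ^ p := Real.rpow_pos_of_pos hr p
  have hC1 : (C : ℝ≥0∞) ≤ ENNReal.ofReal ((C : ℝ) + 1) := by
    rw [← ENNReal.ofReal_coe_nnreal]
    exact ENNReal.ofReal_le_ofReal (by linarith)
  have hone : 1 / ENNReal.ofReal (r ^ p) = ENNReal.ofReal (1 / r ^ p) := by
    rw [ENNReal.ofReal_div_of_pos hrp, ENNReal.ofReal_one]
  calc ENNReal.ofReal (r ^ (p - 1) / (C + 1)) * tailIntegral p a w r
      ≤ ENNReal.ofReal (r ^ (p - 1) / (C + 1)) *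
          (ENNReal.ofReal ((C : ℝ) + 1) * ENNReal.ofReal (1 / r ^ p) *
            (w r * ENNReal.ofReal r)) := by
        gcongr
        refine (hC r hr hra).trans ?_
        rw [hone]
        gcongr
    _ = ENNReal.ofReal (r ^ (p - 1) / (C + 1) * (C + 1) * (1 / r ^ p) * r) * w r := by
        rw [ENNReal.ofReal_mul (by positivity), ENNReal.ofReal_mul (by positivity),
          ENNReal.ofReal_mul (by positivity)]
        ring
    _ = w r := by
        have : r ^ (p - 1) / ((C : ℝ) + 1) * (C + 1) * (1 / r ^ p) * r = 1 := by
          have : (C : ℝ) + 1 ≠ 0 := by positivity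
          rw [Real.rpow_sub_one hr.ne']
          field_simp
        rw [this, ENNReal.ofReal_one, one_mul]

/-- A monotone `B_p` weight which does not vanish identically decays at `0` at most like a power
strictly better than `t ^ (p - 1)`. -/
theorem IsBp.exists_geometric_lower_bound (hp : 1 < p) (h : IsBp p a w) (hw : Monotone w)
    {t₀ : ℝ} (ht₀ : 0 < t₀) (hta : ENNReal.ofReal t₀ < a) (hne : w t₀ ≠ 0) :
    ∃ D η : ℝ, 0 < D ∧ 1 < η ∧
      ∀ k : ℕ, ENNReal.ofReal (D * (η / 2 ^ (p - 1)) ^ k) ≤ w (t₀ / 2 ^ k) := by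
  obtain ⟨C, hC, hCw⟩ := h.exists_tailIntegral_le hw
  have hpos : tailIntegral p a w t₀ ≠ 0 := by
    obtain ⟨s, hs, hsa⟩ := ENNReal.lt_iff_exists_nnreal_btwn.1 hta
    have hts : t₀ < s := by
      rwa [← ENNReal.ofReal_coe_nnreal, ENNReal.ofReal_lt_ofReal_iff_of_nonneg ht₀.le] at hs
    have hsa' : ENNReal.ofReal (s : ℝ) < a := by rwa [ENNReal.ofReal_coe_nnreal]
    refine (lt_of_lt_of_le ?_ ((mul_le_setLIntegral_Ioc (by linarith) hw ht₀ hts).trans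
      (le_self_add.trans (setLIntegral_Ioc_add_tailIntegral_le hts.le hsa')))).ne'
    refine ENNReal.mul_pos hne (ENNReal.ofReal_pos.2 (div_pos (sub_pos.2 hts) ?_)).ne'
    exact Real.rpow_pos_of_pos (ht₀.trans hts) p
  -- A real lower bound suffices, so finiteness of the tail is never needed.
  obtain ⟨d, hd, hdH⟩ : ∃ d : ℝ, 0 < d ∧ ENNReal.ofReal d ≤ tailIntegral p a w t₀ := by
    obtain ⟨d, hd, hdH⟩ := ENNReal.lt_iff_exists_nnreal_btwn.1 (pos_iff_ne_zero.2 hpos)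
    exact ⟨d, by exact_mod_cast hd, by rw [ENNReal.ofReal_coe_nnreal]; exact hdH.le⟩
  have h2p : (0 : ℝ) < 2 ^ p := by positivity
  -- The gain `1 / (2^p C)` is the share of the tail at `r` that `(r/2, r]` is sure to add.
  set η : ℝ := 1 + 1 / (2 ^ p * C) with hη
  have hη1 : 1 < η := by
    have : 0 < 1 / (2 ^ p * C) := by positivity
    linarith
  have hlt : ∀ k : ℕ, ENNReal.ofReal (t₀ / 2 ^ k) < a := fun k =>
    (ENNReal.ofReal_le_ofReal (div_le_self ht₀.le (one_le_pow₀ one_le_two))).trans_lt hta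
  have hstep : ∀ r : ℝ, 0 < r → ENNReal.ofReal r < a →
      ENNReal.ofReal η * tailIntegral p a w r ≤ tailIntegral p a w (r / 2) := by
    intro r hr hra
    have hr2 : 0 < r / 2 := by positivity
    have hr2a : ENNReal.ofReal (r / 2) < a :=
      (ENNReal.ofReal_le_ofReal (by linarith)).trans_lt hra
    have hid : (r / 2) ^ (p - 1) / C * ((r - r / 2) / r ^ p) = 1 / (2 ^ p * C) := by
      rw [Real.rpow_sub_one hr2.ne', Real.div_rpow hr.le zero_le_two]
      have := Real.rpow_pos_of_pos hr p
      field_simp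
      ring
    have hlow : ENNReal.ofReal (1 / (2 ^ p * C)) * tailIntegral p a w r ≤
        ∫⁻ t in Ioc (r / 2) r, w t / ENNReal.ofReal (t ^ p) := by
      refine le_trans ?_ (mul_le_setLIntegral_Ioc (by linarith) hw hr2 (half_lt_self hr))
      rw [← hid, ENNReal.ofReal_mul (by positivity), mul_right_comm]
      gcongr
      refine le_trans ?_ (hCw _ hr2 hr2a)
      gcongr
      exact tailIntegral_antitone (by linarith)
    rw [hη, ENNReal.ofReal_add zero_le_one (by positivity), ENNReal.ofReal_one, add_mul, one_mul,
      add_comm]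
    refine le_trans ?_ (setLIntegral_Ioc_add_tailIntegral_le (by linarith) hra)
    gcongr
  have htail : ∀ k : ℕ, ENNReal.ofReal (d * η ^ k) ≤ tailIntegral p a w (t₀ / 2 ^ k) := by
    intro k
    induction k with
    | zero => simpa using hdH
    | succ k ih =>
      have := hstep (t₀ / 2 ^ k) (by positivity) (hlt k)
      rw [pow_succ, ← mul_assoc, mul_comm _ η, ENNReal.ofReal_mul (by linarith), pow_succ,
        ← div_div]
      refine le_trans ?_ this
      gcongr
  refine ⟨t₀ ^ (p - 1) / C * d, η, by positivity, hη1, fun k => ?_⟩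
  refine le_trans ?_ (hCw _ (by positivity) (hlt k))
  refine le_trans (le_of_eq ?_) (mul_le_mul_right (htail k) _)
  rw [← ENNReal.ofReal_mul (by positivity)]
  congr 1
  rw [Real.div_rpow ht₀.le (by positivity), div_pow, ← Real.rpow_natCast (2 ^ (p - 1)) k,
    ← Real.rpow_natCast 2 k, ← Real.rpow_mul zero_le_two, ← Real.rpow_mul zero_le_two,
    mul_comm (k : ℝ)]
  field_simp

end Weight

/-! ### From sublevel measures to integrability -/

section Rearrangement

variable {R : Type*} [MeasurableSpace R] {μ : Measure R} {f : R → ℝ}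

theorem nondecreasingRearrangement_monotone :
    Monotone (nondecreasingRearrangement μ f) := fun _ _ h =>
  iSup_mono fun _ => iSup_mono fun _ =>
    iSup_mono' fun hs => ⟨hs.trans_le (ENNReal.ofReal_le_ofReal h), le_rfl⟩

theorem lowerDistribution_lt_of_lt_nondecreasingRearrangement {s t : ℝ}
    (h : ENNReal.ofReal s < nondecreasingRearrangement μ f t) :
    lowerDistribution μ f s < ENNReal.ofReal t := by
  simp only [nondecreasingRearrangement, lt_iSup_iff] at h
  obtain ⟨s', _, hs', hss'⟩ := h
  refine lt_of_le_of_lt (measure_mono fun x (hx : |f x| < s) => ?_) hs'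
  exact hx.trans (ENNReal.ofReal_lt_ofReal_iff'.1 hss').1

/-- If the sublevel sets of a function shrink geometrically along a sequence of
levels `s k`, then almost every point is above some level. -/
theorem ae_exists_le_of_measure_lt_le {v : R → ℝ} {s : ℕ → ℝ} {t₀ : ℝ}
    (hE : ∀ k, μ {x | v x < s k} ≤ ENNReal.ofReal (t₀ / 2 ^ k)) :
    ∀ᵐ x ∂μ, ∃ k, s k ≤ v x := by
  rw [ae_iff]
  refine le_antisymm (ge_of_tendsto' (x := Filter.atTop) ?_ fun k =>
    (measure_mono fun x hx => ?_).trans (hE k)) zero_le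
  · have : Filter.Tendsto (fun k : ℕ => t₀ / 2 ^ k) Filter.atTop (nhds 0) := by
      have := (tendsto_pow_atTop_nhds_zero_of_lt_one (r := (1 / 2 : ℝ)) (by norm_num)
        (by norm_num)).const_mul t₀
      simpa [div_eq_mul_inv] using this
    simpa using ENNReal.tendsto_ofReal this
  · simp only [mem_ofPred_eq, not_exists, not_le] at hx
    exact hx k

/-- A negative power of `v` is integrable on a sublevel set when the smaller sublevel sets
shrink fast enough. -/
theorem lintegral_rpow_neg_lt_top {v : R → ℝ} (hv : AEMeasurable v μ) {s : ℕ → ℝ} {t₀ γ : ℝ}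
    (hγ : 0 ≤ γ) (hs : ∀ k, 0 < s k)
    (hE : ∀ k, μ {x | v x < s k} ≤ ENNReal.ofReal (t₀ / 2 ^ k))
    (hsum : Summable fun k => s (k + 1) ^ (-γ) * (t₀ / 2 ^ k)) :
    ∫⁻ x in {x | v x < s 0}, ENNReal.ofReal (v x ^ (-γ)) ∂μ < ∞ := by
  have hmeas : ∀ k, NullMeasurableSet {x | v x < s k} μ := fun k =>
    nullMeasurableSet_lt hv aemeasurable_const
  have hle : ∀ᵐ x ∂μ, x ∈ {x | v x < s 0} → ENNReal.ofReal (v x ^ (-γ)) ≤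
      ∑' k, {x | v x < s k}.indicator (fun _ => ENNReal.ofReal (s (k + 1) ^ (-γ))) x := by
    filter_upwards [ae_exists_le_of_measure_lt_le hE] with x hx hx0
    classical
    -- Taking the first level below `v x` gives `s (k+1) ≤ v x < s k`, even if `s` is not
    -- decreasing.
    have hk0 : Nat.find hx ≠ 0 := fun h0 => by
      have := Nat.find_spec hx
      rw [h0] at this
      exact absurd hx0 (not_lt.2 this)
    obtain ⟨k, hk⟩ := Nat.exists_eq_succ_of_ne_zero hk0
    have hmem : x ∈ {x | v x < s k} := not_le.1 (Nat.find_min hx (by omega))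
    have hsk : s (k + 1) ≤ v x := by simpa [hk] using Nat.find_spec hx
    refine le_trans ?_ (ENNReal.le_tsum k)
    rw [indicator_of_mem hmem]
    exact ENNReal.ofReal_le_ofReal
      (Real.rpow_le_rpow_of_nonpos (hs _) hsk (neg_nonpos.2 hγ))
  calc ∫⁻ x in {x | v x < s 0}, ENNReal.ofReal (v x ^ (-γ)) ∂μ
      ≤ ∫⁻ x in {x | v x < s 0}, ∑' k, {x | v x < s k}.indicator
          (fun _ => ENNReal.ofReal (s (k + 1) ^ (-γ))) x ∂μ :=
        lintegral_mono_ae ((ae_restrict_iff'₀ (hmeas 0)).2 hle)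
    _ ≤ ∫⁻ x, ∑' k, {x | v x < s k}.indicator
          (fun _ => ENNReal.ofReal (s (k + 1) ^ (-γ))) x ∂μ := setLIntegral_le_lintegral _ _
    _ = ∑' k, ENNReal.ofReal (s (k + 1) ^ (-γ)) * μ {x | v x < s k} := by
        rw [lintegral_tsum fun k => aemeasurable_const.indicator₀ (hmeas k)]
        exact tsum_congr fun k => lintegral_indicator_const₀ (hmeas k) _
    _ ≤ ∑' k, ENNReal.ofReal (s (k + 1) ^ (-γ) * (t₀ / 2 ^ k)) := by
        refine ENNReal.tsum_le_tsum fun k => ?_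
        rw [ENNReal.ofReal_mul (Real.rpow_nonneg (hs _).le _)]
        gcongr
        exact hE k
    _ < ∞ := hsum.tsum_ofReal_lt_top

/-- A negative power of a nonnegative function which is integrable over a sublevel set is the sum
of an integrable and a bounded function. -/
theorem memL1AddLinfty_rpow_neg {v : R → ℝ} (hv : AEMeasurable v μ) (hv0 : ∀ x, 0 ≤ v x)
    {σ γ : ℝ} (hγ : 0 ≤ γ) (hσ : 0 < σ)
    (h : ∫⁻ x in {x | v x < σ}, ENNReal.ofReal (v x ^ (-γ)) ∂μ < ∞) :
    MemL1AddLinfty μ fun x => v x ^ (-γ) := by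
  have hE : NullMeasurableSet {x | v x < σ} μ := nullMeasurableSet_lt hv aemeasurable_const
  have hf : AEMeasurable (fun x => v x ^ (-γ)) μ := hv.pow_const _
  refine ⟨{x | v x < σ}.indicator fun x => v x ^ (-γ),
    {x | v x < σ}ᶜ.indicator fun x => v x ^ (-γ), ?_, ?_, ?_⟩
  · rw [memLp_one_iff_integrable]
    refine IntegrableOn.integrable_indicator₀ ?_ hE
    refine ⟨hf.restrict.aestronglyMeasurable, ?_⟩
    rwa [hasFiniteIntegral_iff_ofReal (ae_of_all _ fun x => Real.rpow_nonneg (hv0 x) _)]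
  · refine memLp_top_of_bound (hf.indicator₀ hE.compl).aestronglyMeasurable (σ ^ (-γ))
      (ae_of_all _ fun x => ?_)
    by_cases hx : v x < σ
    · rw [indicator_of_notMem (by simpa using hx), norm_zero]
      positivity
    · rw [indicator_of_mem (by simpa using hx), Real.norm_of_nonneg (Real.rpow_nonneg (hv0 x) _)]
      exact Real.rpow_le_rpow_of_nonpos hσ (not_lt.1 hx) (neg_nonpos.2 hγ)
  · rw [indicator_self_add_compl]

end Rearrangement

end RearrangementHull

open RearrangementHull in
theorem mainTheorem5 {R : Type*} [MeasurableSpace R] (μ : Measure R) [SigmaFinite μ]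
    (hμ : RearrangementHull.IsNonatomic μ) (p : ℝ) (hp : 1 < p)
    (v : R → ℝ) (hv : AEMeasurable v μ) (hv_nonneg : ∀ x, 0 ≤ v x)
    (hv_nonzero : ∃ t : ℝ, 0 < t ∧ ENNReal.ofReal t < μ univ ∧
      RearrangementHull.nondecreasingRearrangement μ v t ≠ 0)
    (hBp : RearrangementHull.IsBp p (μ univ)
      (RearrangementHull.nondecreasingRearrangement μ v)) :
    (∀ᵐ x ∂μ, 0 < v x) ∧
      RearrangementHull.MemL1AddLinfty μ (fun x => v x ^ (-(1 / (p - 1)))) := by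
  obtain ⟨t₀, ht₀, hta, hne⟩ := hv_nonzero
  obtain ⟨D, η, hD, hη, hlow⟩ :=
    hBp.exists_geometric_lower_bound hp nondecreasingRearrangement_monotone ht₀ hta hne
  have hp1 : 0 < p - 1 := sub_pos.2 hp
  have hη0 : 0 < η := one_pos.trans hη
  have hγ : 0 < 1 / (p - 1) := by positivity
  -- Halving `D` puts each level strictly below the rearrangement, as the supremum requires.
  set s : ℕ → ℝ := fun k => D / 2 * (η / 2 ^ (p - 1)) ^ k with hs_def
  have hs : ∀ k, 0 < s k := fun k => by positivity
  have hE : ∀ k, μ {x | v x < s k} ≤ ENNReal.ofReal (t₀ / 2 ^ k) := fun k => by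
    have hlt : ENNReal.ofReal (s k) < nondecreasingRearrangement μ v (t₀ / 2 ^ k) := by
      refine lt_of_lt_of_le ((ENNReal.ofReal_lt_ofReal_iff (by positivity)).2 ?_) (hlow k)
      exact mul_lt_mul_of_pos_right (half_lt_self hD) (by positivity)
    have := lowerDistribution_lt_of_lt_nondecreasingRearrangement hlt
    simp only [lowerDistribution, abs_of_nonneg (hv_nonneg _)] at this
    exact this.le
  have hsum : Summable fun k => s (k + 1) ^ (-(1 / (p - 1))) * (t₀ / 2 ^ k) := by
    have hρ : η ^ (-(1 / (p - 1))) < 1 := Real.rpow_lt_one_of_one_lt_of_neg hη (by linarith)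
    -- The exponent is critical: the factor `2` exactly cancels the halving of the measures, leaving
    -- `η^(-γ)`.
    have hq : (η / 2 ^ (p - 1)) ^ (-(1 / (p - 1))) = η ^ (-(1 / (p - 1))) * 2 := by
      rw [Real.div_rpow hη0.le (by positivity), ← Real.rpow_mul zero_le_two,
        show (p - 1) * -(1 / (p - 1)) = -1 by field_simp, Real.rpow_neg_one, div_inv_eq_mul]
    refine ((summable_geometric_of_lt_one (by positivity) hρ).mul_left
      ((D / 2) ^ (-(1 / (p - 1))) * (η ^ (-(1 / (p - 1))) * 2) * t₀)).congr fun k => ?_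
    rw [hs_def]
    dsimp only
    rw [Real.mul_rpow (by positivity) (by positivity), ← Real.rpow_pow_comm (by positivity), hq,
      mul_pow, pow_succ, pow_succ]
    field_simp
  refine ⟨?_, memL1AddLinfty_rpow_neg hv hv_nonneg hγ.le (hs 0)
    (lintegral_rpow_neg_lt_top hv hγ.le hs hE hsum)⟩
  -- Positivity needs its own argument: a real power with negative exponent is `0` at `0`, so the
  -- decomposition does not see zeros of `v`.
  filter_upwards [ae_exists_le_of_measure_lt_le hE] with x ⟨k, hk⟩
  exact (hs k).trans_le hk
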